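/- Let $(X,d)$ be a nonempty compact metric space and let $T$ be a correspondence on $X$: a map $x\mapsto T(x)$ from $X$ to the nonempty closed subsets of $X$ such that for every $x\in X$ and every open $U\supseteq T(x)$ there is an open $V\ni x$ with $T(y)\subseteq U$ for all $y\in V$. For $n\ge 1$ let $\mathcal O_n(T)=\{(x_1,\dots,x_n)\in X^n: x_{i+1}\in T(x_i),\ 1\le i<n\}$, with the metric $d_n(x,y)=\max_i d(x_i,y_i)$. For a continuous $\phi:\mathcal O_2(T)\to\mathbb R$ put $S_n\phi(x_1,\dots,x_{n+1})=\sum_{i=1}^n\phi(x_i,x_{i+1})$ and $$P(T,\phi)=\lim_{\epsilon\to0^+}\limsup_{n\to\infty}\frac1n\log\,\sup_{E}\sum_{x\in E}e^{S_n\phi(x)}\in(-\infty,+\infty],$$ where $E$ ranges over the subsets of $\mathcal O_{n+1}(T)$ whose distinct points are at $d_{n+1}$-distance at least $\epsilon$. Put $h_{\rm top}(T)=P(T,0)$. A transition probability kernel $\mathcal Q$ on $X$ (with the Borel $\sigma$-algebra) is supported by $T$ if $\mathcal Q_x(T(x))=1$ for every $x\in X$. For such $\mathcal Q$ and a Borel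 probability measure $\mu$ on $X$ let $$\mathfrak h_\mu(\mathcal Q)=\inf\Big\{\int_X\int_{T(x_1)}\phi(x_1,x_2)\,d\mathcal Q_{x_1}(x_2)\,d\mu(x_1)\;:\;\phi\in C(\mathcal O_2(T)),\ P(T,-\phi)\le0\Big\},$$ with $\inf\emptyset=+\infty$. Let $\mathcal P_T(X)$ be the set of $T$-invariant Borel probability measures $\mu$, that is, those with $\mu(A)\le\mu(T^{-1}(A))$ for all Borel $A\subseteq X$, where $T^{-1}(A)=\{x: T(x)\cap A\ne\emptyset\}$ (measured by the completion of $\mu$). For $\mu\in\mathcal P_T(X)$ let $\mathcal K_\mu$ be the set of transition probability kernels $\mathcal Q$ on $X$ supported by $T$ with $\mu\mathcal Q=\mu$, where $(\mu\mathcal Q)(A)=\int_X\mathcal Q_x(A)\,d\mu(x)$, and put $$\mathfrak P_\mu(T,\phi)=\sup_{\mathcal Q\in\mathcal K_\mu}\Big\{\mathfrak h_\mu(\mathcal Q)+\int_X\int_{T(x_1)}\phi(x_1,x_2)\,d\mathcal Q_{x_1}(x_2)\,d\mu(x_1)\Big\},\qquad \mathfrak h_\mu(T)=\sup_{\mathcal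 Q\in\mathcal K_\mu}\mathfrak h_\mu(\mathcal Q).$$ Then for every continuous function $\phi:\mathcal O_2(T)\to\mathbb R$ $$P(T,\phi)=\max_{\mu\in\mathcal P_T(X)}\mathfrak P_\mu(T,\phi),$$ and in particular $$h_{\rm top}(T)=\max_{\mu\in\mathcal P_T(X)}\mathfrak h_\mu(T),$$ as equalities of extended real numbers, both maxima being attained. -/

import Mathlib

open Filter Topology MeasureTheory ProbabilityTheory

noncomputable section

/-- A correspondence on `X`: a map from `X` to the nonempty closed subsets of `X` which is
upper semicontinuous. -/
structure Correspondence (X : Type*) [TopologicalSpace X] where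
  toFun : X → Set X
  nonempty' : ∀ x, (toFun x).Nonempty
  isClosed' : ∀ x, IsClosed (toFun x)
  upperSemicontinuous' : ∀ x, ∀ U : Set X, IsOpen U → toFun x ⊆ U →
    ∃ V : Set X, IsOpen V ∧ x ∈ V ∧ ∀ y ∈ V, toFun y ⊆ U

namespace Correspondence

instance {X : Type*} [TopologicalSpace X] : CoeFun (Correspondence X) (fun _ => X → Set X) :=
  ⟨Correspondence.toFun⟩

/-- The preimage `T⁻¹(A) = {x | T(x) ∩ A ≠ ∅}`. -/
def preimage {X : Type*} [TopologicalSpace X] (T : Correspondence X) (A : Set X) : Set X :=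
  {x | (T x ∩ A).Nonempty}

/-- The space `𝒪₂(T)` of orbits of length two, that is, the graph of `T`. -/
def graph {X : Type*} [TopologicalSpace X] (T : Correspondence X) : Set (X × X) :=
  {p | p.2 ∈ T p.1}

/-- `T.orbits n` is the space `𝒪ₙ₊₁(T)` of orbits `(x₁, …, xₙ₊₁)`, with `xᵢ₊₁ ∈ T(xᵢ)` for
`i = 1, …, n`. When `X` is a metric space, the distance on `Fin (n + 1) → X` is the maximum of
the distances of the coordinates. -/
def orbits {X : Type*} [TopologicalSpace X] (T : Correspondence X) (n : ℕ) :
    Set (Fin (n + 1) → X) :=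
  {x | ∀ i : Fin n, x i.succ ∈ T (x i.castSucc)}

/-- The Birkhoff sum `Sₙφ(x₁, …, xₙ₊₁) = ∑ᵢ φ(xᵢ, xᵢ₊₁)`, `i = 1, …, n`. -/
def birkhoff {X : Type*} [TopologicalSpace X] (T : Correspondence X) (φ : C(T.graph, ℝ)) (n : ℕ)
    (x : T.orbits n) : ℝ :=
  ∑ i : Fin n, φ ⟨(x.1 i.castSucc, x.1 i.succ), x.2 i⟩

/-- `sₙ(T, φ, ε)`: the supremum of `∑_{x ∈ E} exp(Sₙφ(x))` over the `ε`-separated subsets `E` of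
`𝒪ₙ₊₁(T)`. (On a compact space an `ε`-separated set, `ε > 0`, is finite.) -/
def sepSum {X : Type*} [MetricSpace X] (T : Correspondence X) (φ : C(T.graph, ℝ)) (n : ℕ)
    (ε : ℝ) : ENNReal :=
  ⨆ (E : Finset (T.orbits n)) (_ : (E : Set (T.orbits n)).Pairwise fun x y => ε ≤ dist x y),
    ∑ x ∈ E, ENNReal.ofReal (Real.exp (T.birkhoff φ n x))

/-- The exponential growth rate `limsupₙ (1/n) log sₙ(T, φ, ε)`, an extended real number. -/
def sepRate {X : Type*} [MetricSpace X] (T : Correspondence X) (φ : C(T.graph, ℝ))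
    (ε : ℝ) : EReal :=
  limsup (fun n : ℕ => (T.sepSum φ n ε).log / (n : EReal)) atTop

/-- The topological pressure `P(T, φ) = lim_{ε → 0⁺} limsupₙ (1/n) log sₙ(T, φ, ε)`. The limit is
written as a supremum over `ε > 0`; see `tendsto_sepRate`. -/
def pressure {X : Type*} [MetricSpace X] (T : Correspondence X) (φ : C(T.graph, ℝ)) : EReal :=
  ⨆ (ε : ℝ) (_ : 0 < ε), T.sepRate φ ε

theorem sepRate_antitone {X : Type*} [MetricSpace X] (T : Correspondence X) (φ : C(T.graph, ℝ)) :
    Antitone (T.sepRate φ) := by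
  intro ε δ h
  refine limsup_le_limsup (Eventually.of_forall fun n => ?_)
  refine EReal.div_le_div_right_of_nonneg (Nat.cast_nonneg' n) (ENNReal.log_monotone ?_)
  refine iSup_mono fun E => iSup_mono' fun hE => ⟨fun x hx y hy hxy => ?_, le_rfl⟩
  exact h.trans (hE hx hy hxy)

theorem tendsto_sepRate {X : Type*} [MetricSpace X] (T : Correspondence X) (φ : C(T.graph, ℝ)) :
    Tendsto (T.sepRate φ) (𝓝[>] 0) (𝓝 (T.pressure φ)) := by
  have h := (T.sepRate_antitone φ).tendsto_nhdsGT 0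
  rwa [sSup_image] at h

/-- The topological entropy `h_top(T) = P(T, 0)`. -/
def topEntropy {X : Type*} [MetricSpace X] (T : Correspondence X) : EReal :=
  T.pressure 0

/-- The integral `∫_X ∫_{T(x₁)} φ(x₁, x₂) dQ_{x₁}(x₂) dμ(x₁)`. The function `φ`, defined on the
graph of `T` only, is written as its extension by zero to `X × X`. -/
def integralAlong {X : Type*} [TopologicalSpace X] [MeasurableSpace X] (T : Correspondence X)
    (Q : Kernel X X) (μ : Measure X) (φ : C(T.graph, ℝ)) : ℝ :=
  ∫ x₁, ∫ x₂ in T x₁, Function.extend Subtype.val φ 0 (x₁, x₂) ∂(Q x₁) ∂μ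

/-- The integrand of `integralAlong` is `φ` on the domain of integration. -/
theorem extend_apply {X : Type*} [TopologicalSpace X] (T : Correspondence X) (φ : C(T.graph, ℝ))
    {x₁ x₂ : X} (h : x₂ ∈ T x₁) :
    Function.extend Subtype.val φ 0 (x₁, x₂) = φ ⟨(x₁, x₂), h⟩ :=
  Subtype.val_injective.extend_apply φ 0 ⟨(x₁, x₂), h⟩

/-- The abstract measure-theoretic entropy `𝔥_μ(Q)` of a kernel `Q`: the infimum of
`∫∫ φ dQ dμ` over all `φ ∈ C(𝒪₂(T))` with `P(T, -φ) ≤ 0` (so `⊤` if there is no such `φ`). -/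
def kernelEntropy {X : Type*} [MetricSpace X] [MeasurableSpace X] (T : Correspondence X)
    (Q : Kernel X X) (μ : Measure X) : EReal :=
  ⨅ (φ : C(T.graph, ℝ)) (_ : T.pressure (-φ) ≤ 0), (T.integralAlong Q μ φ : EReal)

/-- The set `𝒫_T(X)` of `T`-invariant Borel probability measures. (`T⁻¹(A)` need not be Borel;
`μ (T⁻¹(A))` is its outer measure, which is its measure for the completion of `μ` whenever it is
measurable for that completion.) -/
def invariantMeasures {X : Type*} [TopologicalSpace X] [MeasurableSpace X]
    (T : Correspondence X) : Set (Measure X) :=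
  {μ | IsProbabilityMeasure μ ∧ ∀ A : Set X, MeasurableSet A → μ A ≤ μ (T.preimage A)}

/-- The set `𝒦_μ` of transition probability kernels `Q` on `X` which are supported by `T` and for
which `μ` is invariant, that is, `μQ = μ`. -/
def invariantKernels {X : Type*} [TopologicalSpace X] [MeasurableSpace X]
    (T : Correspondence X) (μ : Measure X) : Set (Kernel X X) :=
  {Q | IsMarkovKernel Q ∧ (∀ x, Q x (T x) = 1) ∧ Q.Invariant μ}

/-- The abstract measure-theoretic pressure `𝔓_μ(T, φ)`. -/
def abstractPressure {X : Type*} [MetricSpace X] [MeasurableSpace X] (T : Correspondence X)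
    (φ : C(T.graph, ℝ)) (μ : Measure X) : EReal :=
  ⨆ Q ∈ T.invariantKernels μ, (T.kernelEntropy Q μ + (T.integralAlong Q μ φ : EReal))

/-- The abstract measure-theoretic entropy `𝔥_μ(T)`. -/
def abstractEntropy {X : Type*} [MetricSpace X] [MeasurableSpace X] (T : Correspondence X)
    (μ : Measure X) : EReal :=
  ⨆ Q ∈ T.invariantKernels μ, T.kernelEntropy Q μ

end Correspondence

end

namespace Correspondence

/-! ### The pressure as a function of the potential. -/

section Pressure

variable {X : Type*} [MetricSpace X] (T : Correspondence X)

/-! The equality is convex duality for `φ ↦ P(T, φ)`. Where finite, the pressure is convex,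
monotone, 1-Lipschitz and compatible with adding constants, and it does not grow when a coboundary
`u(x₂) - u(x₁)` is added.

Upper bound (`kernelEntropy_add_integralAlong_le`): if `r = P(T, φ)` is finite, then `r - φ` is
admissible in the infimum defining the entropy, so the entropy is at most `r - ∫∫ φ`.

Attainment (`exists_pressure_le_kernelEntropy_add`): a subgradient `Λ` of the pressure at `φ` is
positive, normalized and zero on coboundaries. By Riesz it is a probability measure on the graph,
with equal marginals; disintegrating it gives `μ` and `Q`. The tangent inequality at `-ψ` with `P(T,
-ψ) ≤ 0` says `Λ ψ ≥ r - Λ φ`, which bounds the entropy from below.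

If the pressure is `⊤` at one potential, it is `⊤` at all, no potential is admissible and every
entropy is `⊤`; any invariant pair `(μ, Q)` will do, and averages along an orbit supply one. -/

theorem sepSum_le_ofReal_iff (φ : C(T.graph, ℝ)) (n : ℕ) (ε : ℝ) {R : ℝ} (hR : 0 ≤ R) :
    T.sepSum φ n ε ≤ ENNReal.ofReal R ↔
      ∀ E : Finset (T.orbits n), ((E : Set (T.orbits n)).Pairwise fun x y => ε ≤ dist x y) →
        ∑ x ∈ E, Real.exp (T.birkhoff φ n x) ≤ R := by
  unfold sepSum
  rw [iSup₂_le_iff]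
  refine forall₂_congr fun E _ => ?_
  rw [← ENNReal.ofReal_sum_of_nonneg fun _ _ => (Real.exp_pos _).le,
    ENNReal.ofReal_le_ofReal_iff hR]

theorem eventually_sepSum_le_of_pressure_lt {φ : C(T.graph, ℝ)} {a : ℝ} (h : T.pressure φ < a)
    {ε : ℝ} (hε : 0 < ε) :
    ∀ᶠ n : ℕ in atTop, T.sepSum φ n ε ≤ ENNReal.ofReal (Real.exp (n * a)) := by
  have h1 : T.sepRate φ ε < a :=
    (le_iSup₂ (f := fun (ε : ℝ) (_ : 0 < ε) => T.sepRate φ ε) ε hε).trans_lt h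
  filter_upwards [eventually_lt_of_limsup_lt h1, eventually_gt_atTop 0] with n hn hn0
  have h2 := (EReal.div_le_iff_le_mul (by exact_mod_cast hn0) (EReal.natCast_ne_top n)).1 hn.le
  rw [← ENNReal.log_le_log_iff, ENNReal.log_ofReal_of_pos (Real.exp_pos _), Real.log_exp]
  exact_mod_cast h2

theorem pressure_le_of_eventually_sepSum_le {φ : C(T.graph, ℝ)} {a : ℝ}
    (h : ∀ ε : ℝ, 0 < ε → ∀ b : ℝ, a < b →
      ∀ᶠ n : ℕ in atTop, T.sepSum φ n ε ≤ ENNReal.ofReal (Real.exp (n * b))) :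
    T.pressure φ ≤ a := by
  refine iSup₂_le fun ε hε => EReal.le_of_forall_lt_iff_le.1 fun b hb => ?_
  refine limsup_le_of_le (h := ?_)
  filter_upwards [h ε hε b (by exact_mod_cast hb), eventually_gt_atTop 0] with n hn hn0
  refine (EReal.div_le_iff_le_mul (by exact_mod_cast hn0) (EReal.natCast_ne_top n)).2 ?_
  rw [← ENNReal.log_le_log_iff, ENNReal.log_ofReal_of_pos (Real.exp_pos _), Real.log_exp] at hn
  exact_mod_cast hn

/-- If `Sₙφ ≤ Sₙψ + cn + d` for all `n`, then `P(T, φ) ≤ P(T, ψ) + c`. -/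
theorem pressure_le_of_birkhoff_le {φ ψ : C(T.graph, ℝ)} {a c d : ℝ} (hψ : T.pressure ψ ≤ a)
    (h : ∀ n x, T.birkhoff φ n x ≤ T.birkhoff ψ n x + (c * n + d)) :
    T.pressure φ ≤ (a + c : ℝ) := by
  refine T.pressure_le_of_eventually_sepSum_le fun ε hε b hb => ?_
  obtain ⟨a', ha, hab⟩ := exists_between (show a < b - c by linarith)
  have hlim : Tendsto (fun n : ℕ => (n : ℝ) * (b - c - a')) atTop atTop :=
    tendsto_natCast_atTop_atTop.atTop_mul_const (by linarith)
  filter_upwards [T.eventually_sepSum_le_of_pressure_lt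
    (hψ.trans_lt (by exact_mod_cast ha)) hε, hlim.eventually_ge_atTop d] with n hn hd
  rw [sepSum_le_ofReal_iff _ _ _ _ (Real.exp_pos _).le] at hn ⊢
  intro E hE
  calc ∑ x ∈ E, Real.exp (T.birkhoff φ n x)
      ≤ ∑ x ∈ E, Real.exp (T.birkhoff ψ n x) * Real.exp (c * n + d) := by
        refine Finset.sum_le_sum fun x _ => ?_
        rw [← Real.exp_add]
        exact Real.exp_le_exp.2 (h n x)
    _ ≤ Real.exp (n * a') * Real.exp (c * n + d) := by
        rw [← Finset.sum_mul]
        exact mul_le_mul_of_nonneg_right (hn E hE) (Real.exp_pos _).le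
    _ ≤ Real.exp (n * b) := by
        rw [← Real.exp_add]
        refine Real.exp_le_exp.2 ?_
        linarith

theorem birkhoff_add (φ ψ : C(T.graph, ℝ)) (n : ℕ) (x : T.orbits n) :
    T.birkhoff (φ + ψ) n x = T.birkhoff φ n x + T.birkhoff ψ n x := by
  simp [birkhoff, Finset.sum_add_distrib]

theorem birkhoff_smul (a : ℝ) (φ : C(T.graph, ℝ)) (n : ℕ) (x : T.orbits n) :
    T.birkhoff (a • φ) n x = a * T.birkhoff φ n x := by
  simp [birkhoff, Finset.mul_sum]

theorem birkhoff_le_of_le_add {φ ψ : C(T.graph, ℝ)} {c : ℝ} (h : ∀ p, φ p ≤ ψ p + c) (n : ℕ)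
    (x : T.orbits n) : T.birkhoff φ n x ≤ T.birkhoff ψ n x + (c * n + 0) := by
  calc T.birkhoff φ n x ≤ ∑ i : Fin n, (ψ ⟨(x.1 i.castSucc, x.1 i.succ), x.2 i⟩ + c) :=
        Finset.sum_le_sum fun i _ => h _
    _ = _ := by simp [birkhoff, Finset.sum_add_distrib, mul_comm]

theorem pressure_le_of_le_add {φ ψ : C(T.graph, ℝ)} {a c : ℝ} (hψ : T.pressure ψ ≤ a)
    (h : ∀ p, φ p ≤ ψ p + c) : T.pressure φ ≤ (a + c : ℝ) :=
  T.pressure_le_of_birkhoff_le hψ (T.birkhoff_le_of_le_add h)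

theorem pressure_convex {φ ψ : C(T.graph, ℝ)} {a b s t : ℝ} (hφ : T.pressure φ ≤ a)
    (hψ : T.pressure ψ ≤ b) (hs : 0 ≤ s) (ht : 0 ≤ t) (hst : s + t = 1) :
    T.pressure (s • φ + t • ψ) ≤ (s * a + t * b : ℝ) := by
  refine T.pressure_le_of_eventually_sepSum_le fun ε hε c hc => ?_
  set δ := c - (s * a + t * b)
  have hδ : 0 < δ := sub_pos.2 hc
  have hc' : s * (a + δ) + t * (b + δ) = c := by
    have : (s + t) * δ = δ := by rw [hst, one_mul]
    simp only [δ] at this ⊢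
    linarith
  filter_upwards [T.eventually_sepSum_le_of_pressure_lt (a := a + δ)
      (hφ.trans_lt (by exact_mod_cast lt_add_of_pos_right a hδ)) hε,
    T.eventually_sepSum_le_of_pressure_lt (a := b + δ)
      (hψ.trans_lt (by exact_mod_cast lt_add_of_pos_right b hδ)) hε] with n h1 h2
  rw [sepSum_le_ofReal_iff _ _ _ _ (Real.exp_pos _).le] at h1 h2 ⊢
  intro E hE
  -- Dividing each weight by its own growth bound lets pointwise convexity of `exp` do the work of
  -- Hölder's inequality.
  have key : ∀ u v : ℝ, Real.exp (s * u + t * v) ≤ Real.exp (n * c) *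
      (s * (Real.exp u * Real.exp (-(n * (a + δ)))) +
        t * (Real.exp v * Real.exp (-(n * (b + δ))))) := by
    intro u v
    have h := convexOn_exp.2 (Set.mem_univ (u + -(n * (a + δ))))
      (Set.mem_univ (v + -(n * (b + δ)))) hs ht hst
    simp only [smul_eq_mul, Real.exp_add u, Real.exp_add v] at h
    refine le_trans (le_of_eq ?_) (mul_le_mul_of_nonneg_left h (Real.exp_pos _).le)
    rw [← Real.exp_add]
    congr 1
    rw [← hc']
    ring
  have hn : ∀ r : ℝ, Real.exp (n * r) * Real.exp (-(n * r)) = 1 := fun r => by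
    rw [← Real.exp_add, add_neg_cancel, Real.exp_zero]
  calc ∑ x ∈ E, Real.exp (T.birkhoff (s • φ + t • ψ) n x)
      ≤ ∑ x ∈ E, Real.exp (n * c) *
        (s * (Real.exp (T.birkhoff φ n x) * Real.exp (-(n * (a + δ)))) +
          t * (Real.exp (T.birkhoff ψ n x) * Real.exp (-(n * (b + δ))))) := by
        refine Finset.sum_le_sum fun x _ => ?_
        rw [birkhoff_add, birkhoff_smul, birkhoff_smul]
        exact key _ _
    _ = Real.exp (n * c) *
        (s * ((∑ x ∈ E, Real.exp (T.birkhoff φ n x)) * Real.exp (-(n * (a + δ)))) +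
          t * ((∑ x ∈ E, Real.exp (T.birkhoff ψ n x)) * Real.exp (-(n * (b + δ))))) := by
        rw [← Finset.mul_sum, Finset.sum_add_distrib, ← Finset.mul_sum, ← Finset.mul_sum,
          ← Finset.sum_mul, ← Finset.sum_mul]
    _ ≤ Real.exp (n * c) *
        (s * (Real.exp (n * (a + δ)) * Real.exp (-(n * (a + δ)))) +
          t * (Real.exp (n * (b + δ)) * Real.exp (-(n * (b + δ))))) := by
        gcongr
        · exact h1 E hE
        · exact h2 E hE
    _ = Real.exp (n * c) := by rw [hn, hn, mul_one, mul_one, hst, mul_one]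

/-- An orbit of `T` under a choice of a point of each `T x`. -/
noncomputable def someOrbit [Nonempty X] (n : ℕ) : X :=
  (fun x => (T.nonempty' x).some)^[n] (Classical.arbitrary X)

theorem someOrbit_succ_mem [Nonempty X] (n : ℕ) :
    T.someOrbit (n + 1) ∈ T (T.someOrbit n) := by
  unfold someOrbit
  rw [Function.iterate_succ_apply']
  exact (T.nonempty' _).some_mem

/-- A single orbit is a separated set for every `ε`, and its weight is at least `exp (n * c)`. -/
theorem le_pressure_of_le [Nonempty X] {φ : C(T.graph, ℝ)} {c : ℝ} (h : ∀ p, c ≤ φ p) :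
    (c : EReal) ≤ T.pressure φ := by
  by_contra! hlt
  obtain ⟨a, h1, h2⟩ := EReal.lt_iff_exists_real_btwn.1 hlt
  have h2' : a < c := by exact_mod_cast h2
  obtain ⟨n, hn, hn0⟩ := ((T.eventually_sepSum_le_of_pressure_lt h1 one_pos).and
    (eventually_gt_atTop 0)).exists
  rw [sepSum_le_ofReal_iff _ _ _ _ (Real.exp_pos _).le] at hn
  let x : T.orbits n := ⟨fun i => T.someOrbit i, fun i => T.someOrbit_succ_mem i⟩
  have h3 := hn {x} (by simp)
  rw [Finset.sum_singleton, Real.exp_le_exp] at h3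
  have h4 : (n : ℝ) * c ≤ T.birkhoff φ n x := by
    calc (n : ℝ) * c = ∑ _i : Fin n, c := by simp
      _ ≤ _ := Finset.sum_le_sum fun i _ => h _
  have : (n : ℝ) * a < n * c := mul_lt_mul_of_pos_left h2' (by exact_mod_cast hn0)
  linarith

/-- The coordinate projection `(x₁, x₂) ↦ x₁` of the graph of `T`. -/
def graphFst : C(T.graph, X) := ⟨fun p => p.1.1, by fun_prop⟩

/-- The coordinate projection `(x₁, x₂) ↦ x₂` of the graph of `T`. -/
def graphSnd : C(T.graph, X) := ⟨fun p => p.1.2, by fun_prop⟩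

theorem birkhoff_coboundary (u : C(X, ℝ)) (n : ℕ) (x : T.orbits n) :
    T.birkhoff (u.comp T.graphSnd - u.comp T.graphFst) n x = u (x.1 (Fin.last n)) - u (x.1 0) := by
  have h : ∀ (m : ℕ) (y : Fin (m + 1) → X),
      ∑ i : Fin m, (u (y i.succ) - u (y i.castSucc)) = u (y (Fin.last m)) - u (y 0) := by
    intro m y
    induction m with
    | zero => simp
    | succ m ih =>
      rw [Fin.sum_univ_castSucc]
      have := ih fun i => y i.castSucc
      simp only [Fin.succ_castSucc, Fin.succ_last, Fin.castSucc_zero] at this ⊢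
      rw [this]
      ring
  exact h n x.1

/-- Birkhoff sums of a coboundary telescope, so they stay within `2‖u‖` for all `n` and do not
affect the exponential rate. -/
theorem pressure_add_coboundary_le [CompactSpace X] {φ : C(T.graph, ℝ)} {a : ℝ}
    (hφ : T.pressure φ ≤ a) (u : C(X, ℝ)) :
    T.pressure (φ + (u.comp T.graphSnd - u.comp T.graphFst)) ≤ a := by
  have h := T.pressure_le_of_birkhoff_le (φ := φ + (u.comp T.graphSnd - u.comp T.graphFst))
    (c := 0) (d := ‖u‖ + ‖u‖) hφ fun n x => by
      rw [birkhoff_add, birkhoff_coboundary]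
      have h1 := (abs_le.1 (u.norm_coe_le_norm (x.1 (Fin.last n)))).2
      have h2 := (abs_le.1 (u.norm_coe_le_norm (x.1 0))).1
      linarith
  rwa [add_zero] at h

end Pressure

/-! ### Closedness of the graph and measurable selection. -/

theorem isClosed_preimage {X : Type*} [TopologicalSpace X] (T : Correspondence X) {F : Set X}
    (hF : IsClosed F) : IsClosed (T.preimage F) := by
  rw [← isOpen_compl_iff, isOpen_iff_forall_mem_open]
  have h : ∀ x, x ∈ (T.preimage F)ᶜ ↔ T x ⊆ Fᶜ := fun x => by
    rw [Set.mem_compl_iff, preimage, Set.mem_ofPred_eq, Set.not_nonempty_iff_eq_empty,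
      ← Set.disjoint_iff_inter_eq_empty, Set.subset_compl_iff_disjoint_right]
  intro x hx
  obtain ⟨V, hV, hxV, hVT⟩ := T.upperSemicontinuous' x Fᶜ hF.isOpen_compl ((h x).1 hx)
  exact ⟨V, fun y hy => (h y).2 (hVT y hy), hV, hxV⟩

theorem isClosed_graph {X : Type*} [TopologicalSpace X] [RegularSpace X] (T : Correspondence X) :
    IsClosed T.graph := by
  rw [← isOpen_compl_iff, isOpen_iff_forall_mem_open]
  rintro ⟨x, y⟩ hxy
  have h : SeparatedNhds (T x) {y} := by
    rw [separatedNhds_iff_disjoint, nhdsSet_singleton, disjoint_nhdsSet_nhds,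
      (T.isClosed' x).closure_eq]
    exact hxy
  obtain ⟨U, W, hU, hW, hTU, hyW, hd⟩ := h
  obtain ⟨V, hV, hxV, hVT⟩ := T.upperSemicontinuous' x U hU hTU
  refine ⟨V ×ˢ W, ?_, hV.prod hW, hxV, hyW rfl⟩
  rintro ⟨a, b⟩ ⟨ha, hb⟩ hab
  exact Set.disjoint_left.1 hd (hVT a ha hab) hb

/-- A correspondence on a compact metric space has a Borel measurable selection. -/
theorem exists_measurable_selection {X : Type*} [MetricSpace X] [CompactSpace X] [Nonempty X]
    [MeasurableSpace X] [BorelSpace X] (T : Correspondence X) :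
    ∃ f : X → X, Measurable f ∧ ∀ x, f x ∈ T x := by
  -- `X` is a continuous image of the Cantor set, whose order as a subset of `ℝ` singles out the
  -- least parameter of a point of `T x`.
  obtain ⟨g₀, hg₀, hg₀s⟩ := exists_nat_bool_continuous_surjective_of_compact X
  let g : cantorSet → X := g₀ ∘ cantorSetHomeomorphNatToBool
  have hg : Continuous g := hg₀.comp cantorSetHomeomorphNatToBool.continuous
  have hgs : Function.Surjective g := hg₀s.comp cantorSetHomeomorphNatToBool.surjective
  have : CompactSpace cantorSet := isCompact_iff_compactSpace.1 isCompact_cantorSet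
  let S : X → Set ℝ := fun x => Subtype.val '' (g ⁻¹' T x)
  have hSc : ∀ x, IsCompact (S x) := fun x =>
    ((T.isClosed' x).preimage hg).isCompact.image continuous_subtype_val
  have hSm : ∀ x, sInf (S x) ∈ S x := fun x =>
    (hSc x).sInf_mem (((T.nonempty' x).preimage hgs).image _)
  have hSK : ∀ x, sInf (S x) ∈ cantorSet := fun x => by
    obtain ⟨k, -, hk⟩ := hSm x
    exact hk ▸ k.2
  refine ⟨fun x => g ⟨sInf (S x), hSK x⟩, hg.measurable.comp (Measurable.subtype_mk ?_), fun x => ?_⟩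
  · refine measurable_of_Iic fun a => ?_
    -- The least parameter is at most `a` exactly when `T x` meets the image of the parameters in
    -- `(-∞, a]`, a compact set.
    have hcl : IsClosed (g '' (Subtype.val ⁻¹' Set.Iic a)) :=
      ((isClosed_Iic.preimage continuous_subtype_val).isCompact.image hg).isClosed
    convert (T.isClosed_preimage hcl).measurableSet using 1
    ext x
    constructor
    · intro hx
      obtain ⟨k, hk, hkx⟩ := hSm x
      exact ⟨g k, hk, k, by simpa [hkx] using hx, rfl⟩
    · rintro ⟨-, hy, k, hk, rfl⟩
      exact (csInf_le (hSc x).bddBelow ⟨k, hy, rfl⟩).trans hk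
  · obtain ⟨k, hk, hkx⟩ := hSm x
    have : (⟨sInf (S x), hSK x⟩ : cantorSet) = k := Subtype.ext hkx.symm
    simp only [this]
    exact hk

/-! ### Invariant kernels and measures on the graph. -/

section Measure

variable {X : Type*} [MetricSpace X] [CompactSpace X] [MeasurableSpace X] [BorelSpace X]
  (T : Correspondence X)

-- Since `Q x` is carried by `T x`, `Q x A` vanishes off `T⁻¹(A)` and is at most 1 on it; integrate.
-- As `T⁻¹(A)` need not be Borel, its measurable hull is used.
omit [CompactSpace X] in
theorem mem_invariantMeasures_of_mem_invariantKernels {μ : Measure X} [IsProbabilityMeasure μ]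
    {Q : Kernel X X} (hQ : Q ∈ T.invariantKernels μ) : μ ∈ T.invariantMeasures := by
  obtain ⟨_, hQT, hQμ⟩ := hQ
  refine ⟨inferInstance, fun A hA => ?_⟩
  calc μ A = ∫⁻ x, Q x A ∂μ := by
        conv_lhs => rw [← hQμ.def, Measure.bind_apply hA Q.aemeasurable]
    _ ≤ ∫⁻ x, (toMeasurable μ (T.preimage A)).indicator 1 x ∂μ := by
        refine lintegral_mono fun x => ?_
        by_cases hx : x ∈ T.preimage A
        · rw [Set.indicator_of_mem (subset_toMeasurable _ _ hx)]
          exact prob_le_one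
        · have hd : A ⊆ (T x)ᶜ := fun y hy hyT => hx ⟨y, hyT, hy⟩
          have h0 : Q x A = 0 := measure_mono_null hd
            ((prob_compl_eq_zero_iff (T.isClosed' x).measurableSet).2 (hQT x))
          rw [h0]
          exact zero_le
    _ = μ (T.preimage A) := by
        rw [lintegral_indicator_one (measurableSet_toMeasurable _ _), measure_toMeasurable]

/-- A probability measure carried by the graph of `T` and with equal marginals disintegrates over
its marginal into an invariant kernel supported by `T`. -/
theorem exists_invariantKernel_compProd_eq [Nonempty X] {ν : Measure (X × X)}
    [IsProbabilityMeasure ν] (hν : ∀ᵐ p ∂ν, p ∈ T.graph) (h : ν.fst = ν.snd) :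
    ∃ Q ∈ T.invariantKernels ν.fst, ν.fst ⊗ₘ Q = ν := by
  obtain ⟨f, hf, hfT⟩ := T.exists_measurable_selection
  have hdis : ν.fst ⊗ₘ ν.condKernel = ν := ν.disintegrate ν.condKernel
  have hs : MeasurableSet {x | ν.condKernel x (T x) = 1} :=
    (Kernel.measurable_kernel_prodMk_left (κ := ν.condKernel) T.isClosed_graph.measurableSet)
      (measurableSet_singleton 1)
  classical
  -- The conditional kernel is carried by `T x` only for almost every `x`; on the exceptional null
  -- set a Dirac mass at the selection replaces it.
  let Q : Kernel X X := Kernel.piecewise hs ν.condKernel (Kernel.deterministic f hf)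
  have hQ : Q =ᵐ[ν.fst] ν.condKernel := by
    rw [← hdis] at hν
    filter_upwards [Measure.ae_ae_of_ae_compProd hν] with x hx
    have hx1 : ν.condKernel x (T x) = 1 :=
      (mem_ae_iff_prob_eq_one (T.isClosed' x).measurableSet).1 hx
    exact if_pos hx1
  have hQν : ν.fst ⊗ₘ Q = ν := by rw [Measure.compProd_congr hQ, hdis]
  refine ⟨Q, ⟨inferInstance, fun x => ?_, ?_⟩, hQν⟩
  · by_cases hx : ν.condKernel x (T x) = 1
    · have : Q x = ν.condKernel x := if_pos hx
      rw [this, hx]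
    · have : Q x = Measure.dirac (f x) := (if_neg hx).trans (Kernel.deterministic_apply hf x)
      rw [this, Measure.dirac_apply_of_mem (hfT x)]
  · rw [Kernel.Invariant, ← Measure.snd_compProd, hQν, h]

theorem measurableEmbedding_graph_val : MeasurableEmbedding (Subtype.val : T.graph → X × X) :=
  MeasurableEmbedding.subtype_coe T.isClosed_graph.measurableSet

theorem integrable_extend (ψ : C(T.graph, ℝ)) (ν : Measure (X × X)) [IsFiniteMeasure ν] :
    Integrable (Function.extend Subtype.val ψ 0) ν := by
  have : CompactSpace T.graph := isCompact_iff_compactSpace.1 T.isClosed_graph.isCompact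
  refine Integrable.of_bound (T.measurableEmbedding_graph_val.measurable_extend
    ψ.continuous.measurable measurable_const).aestronglyMeasurable ‖ψ‖ (ae_of_all _ fun p => ?_)
  by_cases hp : p ∈ T.graph
  · have h := Subtype.val_injective.extend_apply ψ 0 (⟨p, hp⟩ : T.graph)
    rw [show Function.extend Subtype.val ψ 0 p = ψ ⟨p, hp⟩ from h]
    exact ψ.norm_coe_le_norm _
  · rw [Function.extend_apply' _ _ _ fun ⟨q, hq⟩ => hp (hq ▸ q.2)]
    simp

theorem integralAlong_eq_integral_compProd {μ : Measure X} [IsProbabilityMeasure μ]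
    {Q : Kernel X X} (hQ : Q ∈ T.invariantKernels μ) (ψ : C(T.graph, ℝ)) :
    T.integralAlong Q μ ψ = ∫ p, Function.extend Subtype.val ψ 0 p ∂(μ ⊗ₘ Q) := by
  obtain ⟨_, hQT, -⟩ := hQ
  rw [Measure.integral_compProd (T.integrable_extend ψ _), integralAlong]
  refine integral_congr_ae (ae_of_all _ fun x => ?_)
  beta_reduce
  rw [Measure.restrict_eq_self_of_ae_mem
    ((mem_ae_iff_prob_eq_one (T.isClosed' x).measurableSet).2 (hQT x))]

theorem integral_extend_map_val (m : Measure T.graph) (ψ : C(T.graph, ℝ)) :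
    ∫ p, Function.extend Subtype.val ψ 0 p ∂(m.map Subtype.val) = ∫ p, ψ p ∂m := by
  rw [T.measurableEmbedding_graph_val.integral_map]
  exact integral_congr_ae (ae_of_all _ fun p => Subtype.val_injective.extend_apply ψ 0 p)

/-- The functional `integralAlong Q μ` is the integral for a probability measure on the graph. -/
theorem exists_measure_integralAlong_eq {μ : Measure X} [IsProbabilityMeasure μ]
    {Q : Kernel X X} (hQ : Q ∈ T.invariantKernels μ) :
    ∃ m : Measure T.graph, IsProbabilityMeasure m ∧
      ∀ ψ : C(T.graph, ℝ), T.integralAlong Q μ ψ = ∫ p, ψ p ∂m := by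
  have := hQ.1
  have hae : ∀ᵐ p ∂(μ ⊗ₘ Q), p ∈ T.graph :=
    (Measure.ae_compProd_iff T.isClosed_graph.measurableSet).2 <| ae_of_all _ fun x =>
      (mem_ae_iff_prob_eq_one (T.isClosed' x).measurableSet).2 (hQ.2.1 x)
  have hmap : ((μ ⊗ₘ Q).comap (Subtype.val : T.graph → X × X)).map Subtype.val = μ ⊗ₘ Q := by
    rw [T.measurableEmbedding_graph_val.map_comap, Subtype.range_coe]
    exact Measure.restrict_eq_self_of_ae_mem hae
  refine ⟨(μ ⊗ₘ Q).comap Subtype.val, ⟨?_⟩, fun ψ => ?_⟩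
  · have h1 : (((μ ⊗ₘ Q).comap (Subtype.val : T.graph → X × X)).map Subtype.val) Set.univ = 1 := by
      rw [hmap]
      exact measure_univ
    rwa [Measure.map_apply measurable_subtype_coe MeasurableSet.univ, Set.preimage_univ] at h1
  · rw [T.integralAlong_eq_integral_compProd hQ, ← T.integral_extend_map_val, hmap]

/-- A positive normalized functional on `C(𝒪₂(T))` which vanishes on the coboundaries is given by
an invariant measure and an invariant kernel. -/
theorem exists_integralAlong_eq [Nonempty X] (Λ : C(T.graph, ℝ) →ₗ[ℝ] ℝ)
    (hpos : ∀ ψ, 0 ≤ ψ → 0 ≤ Λ ψ) (hone : Λ 1 = 1)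
    (hcob : ∀ u : C(X, ℝ), Λ (u.comp T.graphSnd - u.comp T.graphFst) = 0) :
    ∃ μ ∈ T.invariantMeasures, ∃ Q ∈ T.invariantKernels μ, ∀ ψ, T.integralAlong Q μ ψ = Λ ψ := by
  have : CompactSpace T.graph := isCompact_iff_compactSpace.1 T.isClosed_graph.isCompact
  let Λ' : CompactlySupportedContinuousMap T.graph ℝ →ₚ[ℝ] ℝ := PositiveLinearMap.mk₀
    { toFun := fun f => Λ f.toContinuousMap
      map_add' := fun f g => Λ.map_add f.toContinuousMap g.toContinuousMap
      map_smul' := fun c f => Λ.map_smul c f.toContinuousMap }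
    fun f hf => hpos _ fun p => hf p
  let m : Measure T.graph := RealRMK.rieszMeasure Λ'
  have hm : ∀ ψ : C(T.graph, ℝ), ∫ p, ψ p ∂m = Λ ψ := fun ψ =>
    RealRMK.integral_rieszMeasure Λ' (CompactlySupportedContinuousMap.continuousMapEquiv ψ)
  have hm1 : IsProbabilityMeasure m := by
    have h := hm 1
    rw [hone] at h
    simp only [ContinuousMap.one_apply, integral_const, smul_eq_mul, mul_one, measureReal_def] at h
    exact ⟨by rwa [ENNReal.toReal_eq_one_iff] at h⟩
  have hint : ∀ ψ : C(T.graph, ℝ), Integrable ψ m := fun ψ =>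
    Integrable.of_bound ψ.continuous.aestronglyMeasurable ‖ψ‖ (ae_of_all _ ψ.norm_coe_le_norm)
  let ν : Measure (X × X) := m.map Subtype.val
  have hνp : IsProbabilityMeasure ν :=
    Measure.isProbabilityMeasure_map measurable_subtype_coe.aemeasurable
  have hν : ∀ᵐ p ∂ν, p ∈ T.graph :=
    (ae_map_iff measurable_subtype_coe.aemeasurable T.isClosed_graph.measurableSet).2
      (ae_of_all _ fun p => p.2)
  -- Vanishing on coboundaries is precisely equality of the two marginals.
  have hfs : ν.fst = ν.snd := by
    refine ext_of_forall_integral_eq_of_IsFiniteMeasure fun u => ?_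
    have h := hcob u.toContinuousMap
    rw [map_sub, ← hm, ← hm, sub_eq_zero] at h
    rw [Measure.fst, Measure.snd, integral_map measurable_fst.aemeasurable
      u.continuous.aestronglyMeasurable, integral_map measurable_snd.aemeasurable
      u.continuous.aestronglyMeasurable, T.measurableEmbedding_graph_val.integral_map,
      T.measurableEmbedding_graph_val.integral_map]
    exact h.symm
  obtain ⟨Q, hQ, hQν⟩ := T.exists_invariantKernel_compProd_eq hν hfs
  refine ⟨ν.fst, T.mem_invariantMeasures_of_mem_invariantKernels hQ, Q, hQ, fun ψ => ?_⟩
  rw [T.integralAlong_eq_integral_compProd hQ, hQν, T.integral_extend_map_val, hm]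

end Measure

end Correspondence

/-! ### Subgradients. -/

/-- A continuous convex function on a normed space has a subgradient at every point. -/
theorem ConvexOn.exists_subgradient {E : Type*} [NormedAddCommGroup E] [NormedSpace ℝ E]
    {P : E → ℝ} (hP : ConvexOn ℝ Set.univ P) (hc : Continuous P) (x : E) :
    ∃ Λ : E →ₗ[ℝ] ℝ, ∀ y, P x + Λ (y - x) ≤ P y := by
  have hopen : IsOpen {p : E × ℝ | p.1 ∈ Set.univ ∧ P p.1 < p.2} := by
    simpa using isOpen_lt (hc.comp continuous_fst) continuous_snd
  obtain ⟨f, hf⟩ := geometric_hahn_banach_open_point hP.convex_strict_epigraph hopen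
    (x := (x, P x)) (by simp)
  have hsplit : ∀ y r, f (y, r) = f (y, 0) + r * f (0, 1) := fun y r => by
    have : (y, r) = (y, (0 : ℝ)) + r • ((0 : E), (1 : ℝ)) := by simp
    rw [this, map_add, map_smul, smul_eq_mul]
  set c := f (0, 1)
  have hlt : ∀ y r, P y < r → f (y, 0) + r * c < f (x, 0) + P x * c := fun y r hr => by
    rw [← hsplit, ← hsplit]
    exact hf _ ⟨Set.mem_univ _, hr⟩
  -- The separating hyperplane is not vertical, so dividing by `-c` makes it a graph.
  have hc0 : c < 0 := by
    have := hlt x (P x + 1) (by linarith)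
    linarith
  have hle : ∀ y, f (y, 0) + P y * c ≤ f (x, 0) + P x * c := fun y => by
    have h : Tendsto (fun r : ℝ => f (y, 0) + r * c) (𝓝[>] (P y)) (𝓝 (f (y, 0) + P y * c)) :=
      (Continuous.tendsto (by fun_prop) _).mono_left nhdsWithin_le_nhds
    exact le_of_tendsto h (eventually_mem_nhdsWithin.mono fun r hr => (hlt y r hr).le)
  refine ⟨(-c)⁻¹ • (f.toLinearMap ∘ₗ LinearMap.inl ℝ E ℝ), fun y => ?_⟩
  have h1 : f (y - x, 0) = f (y, 0) - f (x, 0) := by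
    rw [← map_sub, Prod.mk_sub_mk, sub_zero]
  have h2 : (-c)⁻¹ * f (y - x, 0) ≤ P y - P x := by
    rw [inv_mul_le_iff₀ (neg_pos.2 hc0), h1]
    linarith [hle y]
  change P x + (-c)⁻¹ * f (y - x, 0) ≤ P y
  linarith

/-! ### Invariant and tangent functionals. -/

namespace Correspondence

variable {X : Type*} [MetricSpace X] [CompactSpace X] (T : Correspondence X)

theorem compactSpace_graph : CompactSpace T.graph :=
  isCompact_iff_compactSpace.1 T.isClosed_graph.isCompact

/-- The averages along an orbit have a limit along a nontrivial ultrafilter; it is a positive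
normalized functional which vanishes on the coboundaries. -/
theorem exists_invariant_functional [Nonempty X] :
    ∃ Λ : C(T.graph, ℝ) →ₗ[ℝ] ℝ, (∀ ψ, 0 ≤ ψ → 0 ≤ Λ ψ) ∧ Λ 1 = 1 ∧
      ∀ u : C(X, ℝ), Λ (u.comp T.graphSnd - u.comp T.graphFst) = 0 := by
  have := T.compactSpace_graph
  let q : ℕ → T.graph := fun i => ⟨(T.someOrbit i, T.someOrbit (i + 1)), T.someOrbit_succ_mem i⟩
  let A : ℕ → C(T.graph, ℝ) → ℝ := fun n ψ => (∑ i ∈ Finset.range n, ψ (q i)) / n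
  let F : Ultrafilter ℕ := hyperfilter ℕ
  have hF : (F : Filter ℕ) ≤ atTop := Nat.hyperfilter_le_atTop
  have hlim : ∀ ψ, ∃ l, Tendsto (fun n => A n ψ) F (𝓝 l) := fun ψ => by
    have hb : ∀ n, A n ψ ∈ Set.Icc (-‖ψ‖) ‖ψ‖ := fun n => by
      rw [Set.mem_Icc, ← abs_le, abs_div, Nat.abs_cast]
      refine div_le_of_le_mul₀ n.cast_nonneg (norm_nonneg _) ?_
      calc |∑ i ∈ Finset.range n, ψ (q i)| ≤ ∑ i ∈ Finset.range n, |ψ (q i)| :=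
            Finset.abs_sum_le_sum_abs _ _
        _ ≤ ∑ i ∈ Finset.range n, ‖ψ‖ := Finset.sum_le_sum fun i _ => ψ.norm_coe_le_norm _
        _ = ‖ψ‖ * n := by simp [mul_comm]
    obtain ⟨l, -, hl⟩ := isCompact_Icc.ultrafilter_le_nhds (F.map fun n => A n ψ)
      (tendsto_principal.2 (Eventually.of_forall hb))
    exact ⟨l, hl⟩
  choose Λ hΛ using hlim
  refine ⟨⟨⟨Λ, fun φ ψ => ?_⟩, fun c ψ => ?_⟩, fun ψ hψ => ?_, ?_, fun u => ?_⟩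
  · refine tendsto_nhds_unique (hΛ (φ + ψ)) (((hΛ φ).add (hΛ ψ)).congr fun n => ?_)
    simp [A, Finset.sum_add_distrib, add_div]
  · refine tendsto_nhds_unique (hΛ (c • ψ)) (((hΛ ψ).const_mul c).congr fun n => ?_)
    simp [A, ← Finset.mul_sum, mul_div_assoc]
  · exact ge_of_tendsto' (hΛ ψ) fun n =>
      div_nonneg (Finset.sum_nonneg fun i _ => hψ (q i)) n.cast_nonneg
  · refine tendsto_nhds_unique (hΛ 1) (tendsto_const_nhds.congr' ?_)
    filter_upwards [hF (eventually_gt_atTop 0)] with n hn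
    have : (n : ℝ) ≠ 0 := by exact_mod_cast (show 0 < n from hn).ne'
    simp [A, this]
  · refine tendsto_nhds_unique (hΛ _) (Tendsto.mono_left ?_ hF)
    have hA : ∀ n, A n (u.comp T.graphSnd - u.comp T.graphFst) =
        (u (T.someOrbit n) - u (T.someOrbit 0)) / n := fun n => by
      rw [← Finset.sum_range_sub (fun i => u (T.someOrbit i))]
      rfl
    simp only [hA]
    refine squeeze_zero_norm (a := fun n : ℕ => (‖u‖ + ‖u‖) / n) (fun n => ?_)
      (tendsto_const_div_atTop_nhds_zero_nat _)
    rw [norm_div, Real.norm_natCast]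
    gcongr
    exact (norm_sub_le _ _).trans (add_le_add (u.norm_coe_le_norm _) (u.norm_coe_le_norm _))

theorem pressure_ne_bot [Nonempty X] (φ : C(T.graph, ℝ)) : T.pressure φ ≠ ⊥ := by
  have := T.compactSpace_graph
  exact ((EReal.bot_lt_coe _).trans_le
    (T.le_pressure_of_le fun p => (abs_le.1 (φ.norm_coe_le_norm p)).1)).ne'

/-- Two potentials differ by a bounded function, so finiteness at one gives finiteness at all. -/
theorem pressure_ne_top {φ : C(T.graph, ℝ)} (h : T.pressure φ ≠ ⊤) (ψ : C(T.graph, ℝ)) :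
    T.pressure ψ ≠ ⊤ := by
  have := T.compactSpace_graph
  refine ((T.pressure_le_of_le_add (c := ‖ψ - φ‖) (EReal.le_coe_toReal h) fun p => ?_).trans_lt
    (EReal.coe_lt_top _)).ne
  have h := (abs_le.1 ((ψ - φ).norm_coe_le_norm p)).2
  rw [ContinuousMap.sub_apply] at h
  linarith

/-- A finite pressure function has a tangent functional at every `φ`, and it is positive, normalized
and vanishes on the coboundaries. -/
theorem exists_tangent_functional [Nonempty X] {φ : C(T.graph, ℝ)} (h : T.pressure φ ≠ ⊤) :
    ∃ Λ : C(T.graph, ℝ) →ₗ[ℝ] ℝ, ((∀ ψ, 0 ≤ ψ → 0 ≤ Λ ψ) ∧ Λ 1 = 1 ∧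
      ∀ u : C(X, ℝ), Λ (u.comp T.graphSnd - u.comp T.graphFst) = 0) ∧
      ∀ ψ, T.pressure φ + (Λ (ψ - φ) : EReal) ≤ T.pressure ψ := by
  have := T.compactSpace_graph
  let P : C(T.graph, ℝ) → ℝ := fun ψ => (T.pressure ψ).toReal
  have hP : ∀ ψ, (P ψ : EReal) = T.pressure ψ := fun ψ =>
    EReal.coe_toReal (T.pressure_ne_top h ψ) (T.pressure_ne_bot ψ)
  have hadd : ∀ ψ₁ ψ₂ : C(T.graph, ℝ), ∀ c : ℝ, (∀ p, ψ₁ p ≤ ψ₂ p + c) → P ψ₁ ≤ P ψ₂ + c :=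
    fun ψ₁ ψ₂ c hc => by
      have := T.pressure_le_of_le_add (hP ψ₂).ge hc
      rw [← hP] at this
      exact_mod_cast this
  have hconv : ConvexOn ℝ Set.univ P := by
    refine ⟨convex_univ, fun ψ₁ _ ψ₂ _ s t hs ht hst => ?_⟩
    have := T.pressure_convex (hP ψ₁).ge (hP ψ₂).ge hs ht hst
    rw [← hP] at this
    exact_mod_cast this
  have hlip : LipschitzWith 1 P := LipschitzWith.of_le_add fun ψ₁ ψ₂ => hadd _ _ _ fun p => by
    have := (abs_le.1 (ContinuousMap.dist_apply_le_dist (f := ψ₁) (g := ψ₂) p)).2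
    linarith
  obtain ⟨Λ, hΛ⟩ := hconv.exists_subgradient hlip.continuous φ
  have hΛ' : ∀ ψ, P φ + Λ ψ ≤ P (φ + ψ) := fun ψ => by
    have := hΛ (φ + ψ)
    rwa [add_sub_cancel_left] at this
  -- The tangent inequality in the direction `-ψ` turns upper bounds on the pressure into lower
  -- bounds on `Λ`.
  have hneg : ∀ ψ c, P (φ - ψ) ≤ P φ + c → -c ≤ Λ ψ := fun ψ c hc => by
    have := hΛ' (-ψ)
    rw [map_neg, ← sub_eq_add_neg φ] at this
    linarith
  have hcob : ∀ u : C(X, ℝ), Λ (u.comp T.graphSnd - u.comp T.graphFst) ≤ 0 := fun u => by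
    have h1 := T.pressure_add_coboundary_le (hP φ).ge u
    rw [← hP, EReal.coe_le_coe_iff] at h1
    linarith [hΛ' (u.comp T.graphSnd - u.comp T.graphFst)]
  refine ⟨Λ, ⟨fun ψ hψ => ?_, le_antisymm ?_ ?_, fun u => le_antisymm (hcob u) ?_⟩, fun ψ => ?_⟩
  · have := hneg ψ 0 (hadd _ _ _ fun p => ?_)
    · rwa [neg_zero] at this
    · have : 0 ≤ ψ p := hψ p
      rw [ContinuousMap.sub_apply]
      linarith
  · have := hadd (φ + 1) φ 1 fun p => le_rfl
    linarith [hΛ' 1]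
  · have := hneg 1 (-1) (hadd _ _ _ fun p => (sub_eq_add_neg (φ p) 1).le)
    rwa [neg_neg] at this
  · have h1 := hcob (-u)
    have h2 : (-u).comp T.graphSnd - (-u).comp T.graphFst =
        -(u.comp T.graphSnd - u.comp T.graphFst) := by
      ext p
      simp only [ContinuousMap.sub_apply, ContinuousMap.neg_apply, ContinuousMap.comp_apply]
      ring
    rw [h2, map_neg] at h1
    linarith
  · rw [← hP, ← hP]
    exact_mod_cast hΛ ψ

/-! ### The variational principle. -/

variable [MeasurableSpace X] [BorelSpace X]

theorem kernelEntropy_add_integralAlong_le [Nonempty X] {μ : Measure X} [IsProbabilityMeasure μ]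
    {Q : Kernel X X} (hQ : Q ∈ T.invariantKernels μ) (φ : C(T.graph, ℝ)) :
    T.kernelEntropy Q μ + (T.integralAlong Q μ φ : EReal) ≤ T.pressure φ := by
  have := T.compactSpace_graph
  by_cases h : T.pressure φ = ⊤
  · rw [h]
    exact le_top
  obtain ⟨m, _, hm⟩ := T.exists_measure_integralAlong_eq hQ
  set r := (T.pressure φ).toReal
  have hr : (r : EReal) = T.pressure φ := EReal.coe_toReal h (T.pressure_ne_bot φ)
  -- Subtracting `r` from `φ` brings its pressure down to at most zero, so this `ψ` competes in the
  -- infimum.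
  let ψ : C(T.graph, ℝ) := ContinuousMap.const _ r - φ
  have hψ : T.pressure (-ψ) ≤ 0 := by
    have h1 : T.pressure (-ψ) ≤ (r + -r : ℝ) :=
      T.pressure_le_of_le_add hr.ge fun p => le_of_eq (by simp [ψ, sub_eq_add_neg])
    rwa [add_neg_cancel] at h1
  have hint : Integrable φ m :=
    Integrable.of_bound φ.continuous.aestronglyMeasurable ‖φ‖ (ae_of_all _ φ.norm_coe_le_norm)
  have hval : T.integralAlong Q μ ψ = r - T.integralAlong Q μ φ := by
    rw [hm, hm]
    simp only [ψ, ContinuousMap.sub_apply, ContinuousMap.const_apply]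
    rw [integral_sub (integrable_const r) hint]
    simp
  have hle : T.kernelEntropy Q μ ≤ ((r - T.integralAlong Q μ φ : ℝ) : EReal) :=
    hval ▸ iInf₂_le ψ hψ
  calc T.kernelEntropy Q μ + (T.integralAlong Q μ φ : EReal)
      ≤ ((r - T.integralAlong Q μ φ : ℝ) : EReal) + (T.integralAlong Q μ φ : EReal) := by gcongr
    _ = T.pressure φ := by rw [← EReal.coe_add, sub_add_cancel, hr]

theorem exists_pressure_le_kernelEntropy_add [Nonempty X] (φ : C(T.graph, ℝ)) :
    ∃ μ ∈ T.invariantMeasures, ∃ Q ∈ T.invariantKernels μ,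
      T.pressure φ ≤ T.kernelEntropy Q μ + (T.integralAlong Q μ φ : EReal) := by
  by_cases h : T.pressure φ = ⊤
  · obtain ⟨Λ, hpos, hone, hcob⟩ := T.exists_invariant_functional
    obtain ⟨μ, hμ, Q, hQ, -⟩ := T.exists_integralAlong_eq Λ hpos hone hcob
    refine ⟨μ, hμ, Q, hQ, ?_⟩
    have htop : T.kernelEntropy Q μ = ⊤ :=
      iInf₂_eq_top.2 fun ψ hψ =>
        absurd h (T.pressure_ne_top (hψ.trans_lt EReal.zero_lt_top).ne φ)
    rw [htop, EReal.top_add_coe]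
    exact le_top
  · obtain ⟨Λ, ⟨hpos, hone, hcob⟩, htan⟩ := T.exists_tangent_functional h
    obtain ⟨μ, hμ, Q, hQ, hΛ⟩ := T.exists_integralAlong_eq Λ hpos hone hcob
    refine ⟨μ, hμ, Q, hQ, ?_⟩
    set r := (T.pressure φ).toReal
    have hr : (r : EReal) = T.pressure φ := EReal.coe_toReal h (T.pressure_ne_bot φ)
    have hle : ((r - Λ φ : ℝ) : EReal) ≤ T.kernelEntropy Q μ := by
      refine le_iInf₂ fun ψ hψ => ?_
      -- Admissibility of `ψ` bounds the pressure at `-ψ`, the point where the tangent inequality is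
      -- tested.
      have h1 := (htan (-ψ)).trans hψ
      rw [← hr, map_sub, map_neg] at h1
      have h2 : r + (-Λ ψ - Λ φ) ≤ 0 := by exact_mod_cast h1
      rw [hΛ, EReal.coe_le_coe_iff]
      linarith
    calc T.pressure φ = ((r - Λ φ : ℝ) : EReal) + (T.integralAlong Q μ φ : EReal) := by
          rw [hΛ, ← EReal.coe_add, sub_add_cancel, hr]
      _ ≤ _ := by gcongr

theorem isGreatest_abstractPressure [Nonempty X] (φ : C(T.graph, ℝ)) :
    IsGreatest ((fun μ => T.abstractPressure φ μ) '' T.invariantMeasures) (T.pressure φ) := by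
  have hle : ∀ μ ∈ T.invariantMeasures, T.abstractPressure φ μ ≤ T.pressure φ := fun μ hμ => by
    have := hμ.1
    exact iSup₂_le fun Q hQ => T.kernelEntropy_add_integralAlong_le hQ φ
  obtain ⟨μ, hμ, Q, hQ, h⟩ := T.exists_pressure_le_kernelEntropy_add φ
  refine ⟨⟨μ, hμ, (hle μ hμ).antisymm (h.trans ?_)⟩, ?_⟩
  · exact le_iSup₂ (f := fun Q (_ : Q ∈ T.invariantKernels μ) =>
      T.kernelEntropy Q μ + (T.integralAlong Q μ φ : EReal)) Q hQ
  · rintro _ ⟨ρ, hρ, rfl⟩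
    exact hle ρ hρ

omit [CompactSpace X] [BorelSpace X] in
theorem abstractPressure_zero (μ : Measure X) : T.abstractPressure 0 μ = T.abstractEntropy μ := by
  have h : ∀ Q : Kernel X X, T.integralAlong Q μ 0 = 0 := fun Q => by
    have h0 : ∀ p, Function.extend (Subtype.val : T.graph → X × X) (0 : C(T.graph, ℝ)) 0 p = 0 :=
      fun p => by
        by_cases hp : p ∈ T.graph
        · exact Subtype.val_injective.extend_apply (0 : C(T.graph, ℝ)) 0 (⟨p, hp⟩ : T.graph)
        · exact Function.extend_apply' _ _ _ fun ⟨q, hq⟩ => hp (hq ▸ q.2)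
    simp only [integralAlong, h0, integral_zero]
  simp [abstractPressure, abstractEntropy, h]

end Correspondence

theorem mainTheorem9 {X : Type*} [MetricSpace X] [CompactSpace X] [Nonempty X]
    [MeasurableSpace X] [BorelSpace X] (T : Correspondence X) :
    (∀ φ : C(T.graph, ℝ),
      IsGreatest ((fun μ => T.abstractPressure φ μ) '' T.invariantMeasures) (T.pressure φ)) ∧
    IsGreatest ((fun μ => T.abstractEntropy μ) '' T.invariantMeasures) T.topEntropy := by
  refine ⟨T.isGreatest_abstractPressure, ?_⟩
  have h := T.isGreatest_abstractPressure 0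
  simp only [T.abstractPressure_zero] at h
  exact h
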